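/- Let $d,\kappa\ge 0$ and $n\ge 1$ be integers, and let $a=(a_{ij})_{1\le i\le d,\,0\le j\le n}$ be real numbers with $f^L_i:=a_{i0}<a_{i1}<\dots<a_{in}=:f^U_i$ for every $i$. Let $\mathcal H$ be the set of the subcubes $\prod_{i=1}^d[a_{i,t_i-1},a_{i,t_i}]$, $t\in\{1,\dots,n\}^d$. Let $Q=\prod_{i=1}^dQ_i$, where $Q_i\subset\mathbb R^{n+1}$ is the simplex with vertices $v_{ij}=(a_{i0},\dots,a_{i,j-1},a_{ij},\dots,a_{ij})$, $j=0,\dots,n$. Let $\Lambda=\prod_{i=1}^d\Lambda_i$, where $\Lambda_i=\{\lambda_i\in\mathbb R^{n+1}_{\ge 0}:\sum_{j=0}^n\lambda_{ij}=1\}$, and let $A(\lambda)_i=\sum_{j=0}^na_{ij}\lambda_{ij}$. For each $i$ let $\eta_i^{(1)},\dots,\eta_i^{(n)}\in\{0,1\}^{\lceil\log_2n\rceil}$ be distinct vectors such that adjacent ones differ in at most one component, put $\eta_i^{(0)}:=\eta_i^{(1)}$ and $\eta_i^{(n+1)}:=\eta_i^{(n)}$, and for $l=1,\dots,\lceil\log_2n\rceil$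 let $L_{il}$ (resp. $R_{il}$) be the set of $j\in\{0,\dots,n\}$ for which $\eta^{(j)}_{il}=1$ or $\eta^{(j+1)}_{il}=1$ (resp. $\eta^{(j)}_{il}=0$ or $\eta^{(j+1)}_{il}=0$). For a function $g$ on a convex set $S$, $\mathrm{conc}_S(g)$ denotes its concave envelope, the smallest concave function on $S$ that is at least $g$; $g$ is concave-extendable from $Y\subseteq S$ if the smallest concave function on $S$ that is at least $g$ on $Y$ equals $\mathrm{conc}_S(g)$. Let $\theta=(\theta_1,\dots,\theta_\kappa):\mathbb R^d\to\mathbb R^\kappa$. Suppose that, for every $k$, $\theta_k$ is supermodular over $[f^L,f^U]$, that is, $\theta_k(x\vee y)+\theta_k(x\wedge y)\ge\theta_k(x)+\theta_k(y)$ for all $x,y\in[f^L,f^U]$, and that the function $s\mapsto\theta_k(s_{1n},\dots,s_{dn})$ on $Q$ is concave-extendable from the set of vertices of $Q$. Let $R$ be the set of all $(f,\theta,\lambda,\delta)\in\mathbb R^d\times\mathbb R^\kappa\times\mathbb R^{d\times(n+1)}\times\mathbb R^{d\times\lceil\log_2n\rceil}$ such that $$\theta_k\le\mathrm{conc}_\Lambda(\theta_k\circ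 A)(\lambda)\ \ (k=1,\dots,\kappa),\qquad f=A(\lambda),\qquad \lambda\in\Lambda,\qquad \sum_{j\notin L_{il}}\lambda_{ij}\le\delta_{il}\le1-\sum_{j\notin R_{il}}\lambda_{ij}\ \ \text{for all } i,l.$$ Then $R$, together with the requirement $\delta\in\{0,1\}^{d\times\lceil\log_2n\rceil}$, is an ideal mixed-integer linear programming formulation of $$\bigcup_{H\in\mathcal H}\mathrm{conv}\{(f,\theta):f\in H,\ \theta\le\theta(f)\}.$$ That is: this union is the projection onto the variables $(f,\theta)$ of the set of points of $R$ with binary $\delta$; $R$ is a polyhedron; and $\delta$ is binary at every vertex of $R$. Moreover, for every $k$ and every $\lambda\in\Lambda$, $$\mathrm{conc}_\Lambda(\theta_k\circ A)(\lambda)=\min_{\omega\in\Omega}\Bigl\{\theta_k(\Pi(a;p^0))+\sum_{i=1}^d\ \sum_{t:\,\omega_t=i}\bigl[\theta_k(\Pi(a;p^t))-\theta_k(\Pi(a;p^{t-1}))\bigr]\,(\lambda_{i,p^t_i}+\dots+\lambda_{in})\Bigr\},$$ where $\Omega$ is the set of all $\omega\in\{1,\dots,d\}^{dn}$ in which each $i\in\{1,\dots,d\}$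 occurs exactly $n$ times, $p^0=0$, $p^t=p^{t-1}+e_{\omega_t}$ ($e_i$ being the $i$-th unit vector), and $\Pi(a;p)=(a_{1p_1},\dots,a_{dp_d})$. The formulation uses $d(n+1)$ auxiliary continuous variables $\lambda$ and $d\lceil\log_2n\rceil$ binary variables $\delta$. -/

import Mathlib

/-! ### Envelopes, supermodularity, mixed-integer formulations -/

/-- The concave envelope over `S` of the restriction `g|_Y` of `g` to `Y ⊆ S` (which is `-∞` off `Y`):
the pointwise smallest concave function on `S` that majorizes `g` on `Y`.
The value is `⊤` if no such function exists. For `Y = S` this is the concave envelope of `g` over `S`. -/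
noncomputable def concEnv {E : Type*} [AddCommGroup E] [Module ℝ E]
    (S Y : Set E) (g : E → ℝ) (x : E) : EReal :=
  ⨅ h ∈ {h : E → ℝ | ConcaveOn ℝ S h ∧ ∀ y ∈ Y, g y ≤ h y}, (h x : EReal)

/-- `g : S → ℝ` is concave-extendable from `Y ⊆ S`: the concave envelopes of `g` and of `g|_Y`
over `S` are identical. -/
def ConcaveExtendable {E : Type*} [AddCommGroup E] [Module ℝ E]
    (S Y : Set E) (g : E → ℝ) : Prop :=
  ∀ x ∈ S, concEnv S S g x = concEnv S Y g x

/-- Supermodularity over a set `B` (closed under componentwise maxima and minima). -/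
def SupermodularOver {d : ℕ} (B : Set (Fin d → ℝ)) (φ : (Fin d → ℝ) → ℝ) : Prop :=
  ∀ x ∈ B, ∀ y ∈ B, φ x + φ y ≤ φ (x ⊔ y) + φ (x ⊓ y)

/-- A polyhedron: the solution set of finitely many linear inequalities. -/
def IsPolyhedron {E : Type*} [AddCommGroup E] [Module ℝ E] (R : Set E) : Prop :=
  ∃ (m : ℕ) (ℓ : Fin m → E →ₗ[ℝ] ℝ) (b : Fin m → ℝ), R = {x | ∀ i, ℓ i x ≤ b i}

/-- The points of `R`, in the space of variables `(x, y, δ)`, for which `δ` is binary. -/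
def binaryPoints {X Y β : Type*} (R : Set (X × Y × (β → ℝ))) : Set (X × Y × (β → ℝ)) :=
  {p | p ∈ R ∧ ∀ b, p.2.2 b = 0 ∨ p.2.2 b = 1}

/-- The mixed-integer set with continuous relaxation `R` and binary variables `δ` is an ideal
mixed-integer linear programming formulation of `S`: its projection onto `x` is `S`, the set `R`
is a polyhedron, and `δ` is binary at every vertex of `R`. -/
structure IsIdealMILPFormulation {X Y β : Type*} [AddCommGroup X] [Module ℝ X]
    [AddCommGroup Y] [Module ℝ Y] (S : Set X) (R : Set (X × Y × (β → ℝ))) : Prop where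
  proj_eq : Prod.fst '' binaryPoints R = S
  polyhedron : IsPolyhedron R
  ideal : ∀ p ∈ Set.extremePoints ℝ R, ∀ b, p.2.2 b = 0 ∨ p.2.2 b = 1

/-! ### The discretization -/

/-- The box `[f^L, f^U]`, with `f^L_i = a_{i0}` and `f^U_i = a_{in}`. -/
def box {d n : ℕ} (a : Fin d → Fin (n + 1) → ℝ) : Set (Fin d → ℝ) :=
  Set.Icc (fun i => a i 0) (fun i => a i (Fin.last n))

/-- The subcube `∏ i, [a_{i,t_i-1}, a_{i,t_i}]`; here `t_i` is counted from `0`. -/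
def subcube {d n : ℕ} (a : Fin d → Fin (n + 1) → ℝ) (t : Fin d → Fin n) : Set (Fin d → ℝ) :=
  Set.Icc (fun i => a i (t i).castSucc) (fun i => a i (t i).succ)

/-- The hypograph of the restriction of the vector of functions `θ` to `H`. -/
def hypo {d κ : ℕ} (H : Set (Fin d → ℝ)) (θ : (Fin d → ℝ) → Fin κ → ℝ) :
    Set ((Fin d → ℝ) × (Fin κ → ℝ)) :=
  {p | p.1 ∈ H ∧ ∀ k, p.2 k ≤ θ p.1 k}

/-- The union, over all subcubes `H` of the subdivision, of `conv (hypo (θ|_H))`. -/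
def unionConvHypo {d n κ : ℕ} (a : Fin d → Fin (n + 1) → ℝ) (θ : (Fin d → ℝ) → Fin κ → ℝ) :
    Set ((Fin d → ℝ) × (Fin κ → ℝ)) :=
  ⋃ t : Fin d → Fin n, convexHull ℝ (hypo (subcube a t) θ)

/-- The point `v_{ij} = (a_{i0}, …, a_{i,j-1}, a_{ij}, …, a_{ij})`. -/
def simplexVertex {d n : ℕ} (a : Fin d → Fin (n + 1) → ℝ) (i : Fin d) (j : Fin (n + 1)) :
    Fin (n + 1) → ℝ :=
  fun j' => a i (min j' j)

/-- `Q = ∏ i, Q_i`, where `Q_i` is the simplex with vertices `v_{i0}, …, v_{in}`. -/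
def polytopeQ {d n : ℕ} (a : Fin d → Fin (n + 1) → ℝ) : Set (Fin d → Fin (n + 1) → ℝ) :=
  Set.univ.pi fun i => convexHull ℝ (Set.range (simplexVertex a i))

/-- The function `s ↦ φ(s_{1n}, …, s_{dn})`. -/
def liftLast {d n : ℕ} (φ : (Fin d → ℝ) → ℝ) (s : Fin d → Fin (n + 1) → ℝ) : ℝ :=
  φ fun i => s i (Fin.last n)

/-- `Λ = ∏ i, Λ_i`, where `Λ_i` is the standard simplex in `ℝ^{n+1}`. -/
def Lam (d n : ℕ) : Set (Fin d → Fin (n + 1) → ℝ) :=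
  Set.univ.pi fun _ => stdSimplex ℝ (Fin (n + 1))

/-- `A(λ)_i = ∑ j, a_{ij} λ_{ij}`. -/
def mapA {d n : ℕ} (a : Fin d → Fin (n + 1) → ℝ) (l : Fin d → Fin (n + 1) → ℝ) : Fin d → ℝ :=
  fun i => ∑ j, a i j * l i j

/-! ### Staircases -/

/-- Direction vectors in the grid `{0, …, n}^d`: every direction `i` occurs exactly `n` times. -/
def DirectionVector (d n : ℕ) : Type :=
  {ω : Fin (d * n) → Fin d // ∀ i, (Finset.univ.filter fun t => ω t = i).card = n}

/-- The `t`-th point `p^t` of the staircase of `ω`: `p^t_i` is the number of moves in direction `i`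
among the first `t` moves. -/
def DirectionVector.point {d n : ℕ} (ω : DirectionVector d n) (t : ℕ) (i : Fin d) : Fin (n + 1) :=
  ⟨(Finset.univ.filter fun t' : Fin (d * n) => (t' : ℕ) < t ∧ ω.1 t' = i).card, by
    have h := Finset.card_le_card
      (Finset.monotone_filter_right (Finset.univ : Finset (Fin (d * n)))
        (p := fun t' : Fin (d * n) => (t' : ℕ) < t ∧ ω.1 t' = i) (q := fun t' => ω.1 t' = i)
        fun _ _ h => h.2)
    rw [ω.2 i] at h
    omega⟩

/-- `Π(a; p) = (a_{1 p_1}, …, a_{d p_d})`. -/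
def gridValue {d n : ℕ} (a : Fin d → Fin (n + 1) → ℝ) (p : Fin d → Fin (n + 1)) : Fin d → ℝ :=
  fun i => a i (p i)

/-- The affine function of `λ` given by the staircase of `ω`,
`φ(Π(a;p^0)) + ∑ i, ∑_{t : ω_t = i} [φ(Π(a;p^t)) - φ(Π(a;p^{t-1}))] (λ_{i,p^t_i} + ⋯ + λ_{in})`.
Moves are counted from `0` here: move `t` leads from `p^t` to `p^{t+1}`. -/
def staircaseFn {d n : ℕ} (a : Fin d → Fin (n + 1) → ℝ) (φ : (Fin d → ℝ) → ℝ)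
    (ω : DirectionVector d n) (l : Fin d → Fin (n + 1) → ℝ) : ℝ :=
  φ (gridValue a (ω.point 0)) +
    ∑ i, ∑ t ∈ Finset.univ.filter (fun t : Fin (d * n) => ω.1 t = i),
      (φ (gridValue a (ω.point (t + 1))) - φ (gridValue a (ω.point t))) *
        ∑ j ∈ Finset.Ici (ω.point (t + 1) i), l i j

/-! ### Logarithmic SOS2 constraints -/

/-- `η^(1), …, η^(n)` are distinct binary vectors, and adjacent ones differ in at most one
component. Only the values `η t` with `1 ≤ t ≤ n` matter. -/
def IsGrayCode (n : ℕ) {m : ℕ} (η : ℕ → Fin m → Bool) : Prop :=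
  Set.InjOn η (Set.Icc 1 n) ∧ ∀ t, 1 ≤ t → t + 1 ≤ n → hammingDist (η t) (η (t + 1)) ≤ 1

/-- The code extended by `η^(0) = η^(1)` and `η^(n+1) = η^(n)`. -/
def grayExt (n : ℕ) {m : ℕ} (η : ℕ → Fin m → Bool) (t : ℕ) : Fin m → Bool :=
  η (max 1 (min t n))

/-- `L_k` for `b = true`, and `R_k` for `b = false`: the `j` in `{0, …, n}` for which
`η^(j)_k = b` or `η^(j+1)_k = b`. -/
def codeSet (n : ℕ) {m : ℕ} (η : ℕ → Fin m → Bool) (b : Bool) (k : Fin m) :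
    Finset (Fin (n + 1)) :=
  Finset.univ.filter fun j => grayExt n η j k = b ∨ grayExt n η (j + 1) k = b

/-- The continuous relaxation (integrality of `δ` dropped) of the logarithmic SOS2 constraints on
`(λ_i, δ_i)`. The bounds `0 ≤ δ_{ik} ≤ 1` are implied. -/
def LogSOS2 {n m : ℕ} (η : ℕ → Fin m → Bool) (l : Fin (n + 1) → ℝ) (δ : Fin m → ℝ) : Prop :=
  l ∈ stdSimplex ℝ (Fin (n + 1)) ∧
    ∀ k, ∑ j ∈ (codeSet n η true k)ᶜ, l j ≤ δ k ∧
      δ k ≤ 1 - ∑ j ∈ (codeSet n η false k)ᶜ, l j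

/-! ### The formulation -/

/-- The space of the auxiliary continuous variables `λ`. -/
abbrev LamSpace (d n : ℕ) : Type := Fin d → Fin (n + 1) → ℝ

/-- The index set of the binary variables `δ_{ik}`, `k = 1, …, ⌈log₂ n⌉`. -/
abbrev BinIdx (d n : ℕ) : Type := Fin d × Fin (Nat.clog 2 n)

/-- The continuous relaxation, in the variables `((f, θ), λ, δ)`, of the formulation
`θ_k ≤ conc_Λ(θ_k ∘ A)(λ)`, `f = A(λ)`, and `(λ_i, δ_i)` satisfies the logarithmic SOS2
constraints. -/
def envelopeRelaxation {d n κ : ℕ} (a : Fin d → Fin (n + 1) → ℝ)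
    (θ : (Fin d → ℝ) → Fin κ → ℝ) (η : Fin d → ℕ → Fin (Nat.clog 2 n) → Bool) :
    Set (((Fin d → ℝ) × (Fin κ → ℝ)) × LamSpace d n × (BinIdx d n → ℝ)) :=
  {p | (∀ k, (p.1.2 k : EReal) ≤
          concEnv (Lam d n) (Lam d n) (fun l => θ (mapA a l) k) p.2.1) ∧
        p.1.1 = mapA a p.2.1 ∧
        ∀ i, LogSOS2 (η i) (p.2.1 i) (fun k => p.2.2 (i, k))}

/-! ### Staircases -/

/-! Each staircase function is affine in `λ`, and the envelope is squeezed between two facts about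
these functions. Upper bound: truncate a staircase at a grid point `p` by taking meets.
Supermodularity says that a move below `p` gains at least as much as its truncation, and telescoping
gives domination at all vertices of `Λ` (`le_staircaseFn_lamVertex`). Concave extendability on `Q`,
transported along the affine map `lamToQ`, spreads this to all of `Λ` (`le_staircaseFn`). Lower
bound: given `λ`, order the moves by decreasing tail sum. Summation by parts writes `λ` as a convex
combination of vertices on that staircase, and its staircase function takes the matching combination
of values (`exists_staircase_decomposition`), which no concave majorant can go below.

Hence the envelope is a minimum of finitely many affine functions, and the relaxation is a
polyhedron. The same decomposition lifts to a point of the relaxation: each grid point receives the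
same slack in `θ` and the same relative position of `δ` between its bounds. So at an extreme point
`λ` is a vertex of `Λ`; the bounds on each `δ` are then 0 or 1, which makes `δ` binary. For the
projection, binary `δ` selects one code word. The Gray property and injectivity confine each `λ_i`
to the two ends of one segment, so the decomposition uses only corners of one subcube. Conversely,
fixing `δ` at the complemented code words of a subcube leaves a convex slice whose projection
contains the hypograph over that subcube. -/

/-- The tail sum `l_{i,m} + ⋯ + l_{i,n}`. -/
def tailSum {d n : ℕ} (l : Fin d → Fin (n + 1) → ℝ) (i : Fin d) (m : ℕ) : ℝ :=
  ∑ j : Fin (n + 1), if m ≤ (j : ℕ) then l i j else 0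

/-- The vertex of `Λ` that corresponds to the grid point `p`. -/
def lamVertex {d n : ℕ} (p : Fin d → Fin (n + 1)) : Fin d → Fin (n + 1) → ℝ :=
  fun i j => if p i = j then 1 else 0

theorem sum_Ici_eq_tailSum {d n : ℕ} (l : Fin d → Fin (n + 1) → ℝ) (i : Fin d)
    (x : Fin (n + 1)) : ∑ j ∈ Finset.Ici x, l i j = tailSum l i x := by
  rw [tailSum, ← Finset.sum_filter]
  refine Finset.sum_congr (Finset.ext fun j => ?_) fun _ _ => rfl
  rw [Finset.mem_Ici, Finset.mem_filter, Fin.le_def]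
  simp

theorem tailSum_sub_tailSum_succ {d n : ℕ} (l : Fin d → Fin (n + 1) → ℝ) (i : Fin d)
    (j : Fin (n + 1)) : tailSum l i j - tailSum l i (j + 1) = l i j := by
  rw [tailSum, tailSum, ← Finset.sum_sub_distrib, Finset.sum_eq_single j]
  · simp
  · intro b _ hb
    have : (b : ℕ) ≠ j := fun h => hb (Fin.ext h)
    by_cases h : (j : ℕ) ≤ b
    · rw [if_pos h, if_pos (by omega), sub_self]
    · rw [if_neg h, if_neg (by omega), sub_self]
  · simp

theorem tailSum_nonneg {d n : ℕ} {l : Fin d → Fin (n + 1) → ℝ} (hl : l ∈ Lam d n) (i : Fin d)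
    (m : ℕ) : 0 ≤ tailSum l i m :=
  Finset.sum_nonneg fun j _ => by
    split_ifs
    exacts [(hl i trivial).1 j, le_rfl]

theorem tailSum_antitone {d n : ℕ} {l : Fin d → Fin (n + 1) → ℝ} (hl : l ∈ Lam d n)
    (i : Fin d) : Antitone (tailSum l i) := by
  intro m m' h
  refine Finset.sum_le_sum fun j _ => ?_
  split_ifs with h1 h2 h2
  exacts [le_rfl, absurd (h.trans h1) h2, (hl i trivial).1 j, le_rfl]

theorem tailSum_zero {d n : ℕ} {l : Fin d → Fin (n + 1) → ℝ} (hl : l ∈ Lam d n)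
    (i : Fin d) : tailSum l i 0 = 1 := by
  simpa [tailSum] using (hl i trivial).2

theorem tailSum_lamVertex {d n : ℕ} (p : Fin d → Fin (n + 1)) (i : Fin d) (m : ℕ) :
    tailSum (lamVertex p) i m = if m ≤ (p i : ℕ) then 1 else 0 := by
  rw [tailSum, Finset.sum_eq_single (p i)] <;> simp +contextual [lamVertex, eq_comm]

theorem lamVertex_mem {d n : ℕ} (p : Fin d → Fin (n + 1)) : lamVertex p ∈ Lam d n := by
  intro i _
  refine ⟨fun j => ?_, by simp [lamVertex]⟩
  simp only [lamVertex]
  split_ifs <;> norm_num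

theorem mapA_lamVertex {d n : ℕ} (a : Fin d → Fin (n + 1) → ℝ) (p : Fin d → Fin (n + 1)) :
    mapA a (lamVertex p) = gridValue a p := by
  ext i
  simp [mapA, lamVertex, gridValue]

namespace DirectionVector

variable {d n : ℕ} (ω : DirectionVector d n)

theorem point_zero : ω.point 0 = 0 := by
  ext i
  simp [point]

theorem point_succ (t : Fin (d * n)) (i : Fin d) :
    (ω.point (t + 1) i : ℕ) = ω.point t i + if ω.1 t = i then 1 else 0 := by
  have h : (Finset.univ.filter fun t' : Fin (d * n) => (t' : ℕ) < t + 1 ∧ ω.1 t' = i) =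
      (Finset.univ.filter fun t' : Fin (d * n) => (t' : ℕ) < t ∧ ω.1 t' = i) ∪
        if ω.1 t = i then {t} else ∅ := by
    ext t'
    by_cases htt : t' = t
    · subst htt
      by_cases hi : ω.1 t' = i <;> simp [hi]
    · have : (t' : ℕ) ≠ t := fun h => htt (Fin.ext h)
      have h2 : (t' : ℕ) < t + 1 ↔ (t' : ℕ) < t := by omega
      rw [Finset.mem_union, Finset.mem_filter, Finset.mem_filter, h2]
      split_ifs <;> simp [htt]
  simp only [point]
  rw [h, Finset.card_union_of_disjoint]
  · split_ifs <;> simp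
  · split_ifs <;> simp

theorem point_succ_self (t : Fin (d * n)) :
    (ω.point (t + 1) (ω.1 t) : ℕ) = ω.point t (ω.1 t) + 1 := by
  simp [point_succ]

theorem point_succ_of_ne (t : Fin (d * n)) {i : Fin d} (h : ω.1 t ≠ i) :
    ω.point (t + 1) i = ω.point t i := by
  apply Fin.ext
  simp [point_succ, h]

theorem point_last : ω.point (d * n) = fun _ => Fin.last n := by
  ext i
  simp [point, ω.2 i]

end DirectionVector

/-- A single sum in the order of the moves is the form in which telescoping and summation by parts
apply. -/
theorem staircaseFn_eq {d n : ℕ} (a : Fin d → Fin (n + 1) → ℝ) (φ : (Fin d → ℝ) → ℝ)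
    (ω : DirectionVector d n) (l : Fin d → Fin (n + 1) → ℝ) :
    staircaseFn a φ ω l = φ (gridValue a (ω.point 0)) +
      ∑ t : Fin (d * n), (φ (gridValue a (ω.point (t + 1))) - φ (gridValue a (ω.point t))) *
        tailSum l (ω.1 t) (ω.point (t + 1) (ω.1 t)) := by
  rw [staircaseFn, ← Finset.sum_fiberwise (s := Finset.univ) (g := ω.1)]
  congr 1
  refine Finset.sum_congr rfl fun i _ => Finset.sum_congr rfl fun t ht => ?_
  rw [(Finset.mem_filter.1 ht).2, sum_Ici_eq_tailSum]

/-! ### Upper bound: staircase functions as majorants. -/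

theorem gridValue_sup {d n : ℕ} {a : Fin d → Fin (n + 1) → ℝ} (ha : ∀ i, StrictMono (a i))
    (p q : Fin d → Fin (n + 1)) : gridValue a (p ⊔ q) = gridValue a p ⊔ gridValue a q := by
  ext i
  exact (ha i).monotone.map_sup _ _

theorem gridValue_inf {d n : ℕ} {a : Fin d → Fin (n + 1) → ℝ} (ha : ∀ i, StrictMono (a i))
    (p q : Fin d → Fin (n + 1)) : gridValue a (p ⊓ q) = gridValue a p ⊓ gridValue a q := by
  ext i
  exact (ha i).monotone.map_inf _ _

theorem gridValue_mem_box {d n : ℕ} {a : Fin d → Fin (n + 1) → ℝ} (ha : ∀ i, StrictMono (a i))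
    (p : Fin d → Fin (n + 1)) : gridValue a p ∈ box a :=
  ⟨fun i => (ha i).monotone (Fin.zero_le _), fun i => (ha i).monotone (Fin.le_last _)⟩

/-- A staircase function of a supermodular function majorizes it at the grid points. -/
theorem le_staircaseFn_lamVertex {d n : ℕ} {a : Fin d → Fin (n + 1) → ℝ}
    (ha : ∀ i, StrictMono (a i)) {φ : (Fin d → ℝ) → ℝ} (hφ : SupermodularOver (box a) φ)
    (ω : DirectionVector d n) (p : Fin d → Fin (n + 1)) :
    φ (gridValue a p) ≤ staircaseFn a φ ω (lamVertex p) := by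
  have key : ∀ t : Fin (d * n),
      φ (gridValue a (ω.point (t + 1) ⊓ p)) - φ (gridValue a (ω.point t ⊓ p)) ≤
      (φ (gridValue a (ω.point (t + 1))) - φ (gridValue a (ω.point t))) *
        tailSum (lamVertex p) (ω.1 t) (ω.point (t + 1) (ω.1 t)) := by
    intro t
    have hs := ω.point_succ_self t
    rw [tailSum_lamVertex]
    split_ifs with h
    -- The move stays below `p`: supermodularity is applied to `p^t` and `p^{t+1} ⊓ p`.
    · have h1 : ω.point t ⊔ (ω.point (t + 1) ⊓ p) = ω.point (t + 1) := by
        ext i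
        by_cases hi : ω.1 t = i
        · subst hi
          simp only [Pi.sup_apply, Pi.inf_apply, Fin.coe_max, Fin.coe_min]
          omega
        · simp [ω.point_succ_of_ne t hi]
      have h2 : ω.point t ⊓ (ω.point (t + 1) ⊓ p) = ω.point t ⊓ p := by
        ext i
        by_cases hi : ω.1 t = i
        · subst hi
          simp only [Pi.inf_apply, Fin.coe_min]
          omega
        · simp [ω.point_succ_of_ne t hi]
      have := hφ _ (gridValue_mem_box ha (ω.point t)) _
        (gridValue_mem_box ha (ω.point (t + 1) ⊓ p))
      rw [← gridValue_sup ha, ← gridValue_inf ha, h1, h2] at this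
      linarith
    -- The move passes beyond `p`: truncation does not see it, and both sides are zero.
    · have h1 : ω.point (t + 1) ⊓ p = ω.point t ⊓ p := by
        ext i
        by_cases hi : ω.1 t = i
        · subst hi
          simp only [Pi.inf_apply, Fin.coe_min]
          omega
        · simp [ω.point_succ_of_ne t hi]
      simp [h1]
  have tel : ∑ t : Fin (d * n),
      (φ (gridValue a (ω.point (t + 1) ⊓ p)) - φ (gridValue a (ω.point t ⊓ p))) =
      φ (gridValue a p) - φ (gridValue a (ω.point 0)) := by
    rw [Fin.sum_univ_eq_sum_range
      (fun t => φ (gridValue a (ω.point (t + 1) ⊓ p)) - φ (gridValue a (ω.point t ⊓ p))),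
      Finset.sum_range_sub (fun t => φ (gridValue a (ω.point t ⊓ p)))]
    have h1 : ω.point (d * n) ⊓ p = p := by
      rw [ω.point_last]
      exact inf_eq_right.2 fun i => Fin.le_last _
    have h0 : ω.point 0 ⊓ p = ω.point 0 := by
      rw [ω.point_zero]
      exact inf_eq_left.2 fun i => Fin.zero_le _
    rw [h1, h0]
  rw [staircaseFn_eq]
  have := Finset.sum_le_sum fun t (_ : t ∈ Finset.univ) => key t
  linarith

/-- The affine map from `Λ` onto `Q`. -/
def lamToQ {d n : ℕ} (a : Fin d → Fin (n + 1) → ℝ) (l : Fin d → Fin (n + 1) → ℝ) :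
    Fin d → Fin (n + 1) → ℝ :=
  fun i => ∑ j, l i j • simplexVertex a i j

theorem lamToQ_mem {d n : ℕ} (a : Fin d → Fin (n + 1) → ℝ) {l : Fin d → Fin (n + 1) → ℝ}
    (hl : l ∈ Lam d n) : lamToQ a l ∈ polytopeQ a := fun i _ =>
  (convex_convexHull ℝ _).sum_mem (fun j _ => (hl i trivial).1 j) (hl i trivial).2
    fun j _ => subset_convexHull ℝ _ ⟨j, rfl⟩

theorem liftLast_lamToQ {d n : ℕ} (a : Fin d → Fin (n + 1) → ℝ) (φ : (Fin d → ℝ) → ℝ)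
    (l : Fin d → Fin (n + 1) → ℝ) : liftLast φ (lamToQ a l) = φ (mapA a l) := by
  unfold liftLast
  congr 1
  ext i
  simp [lamToQ, mapA, simplexVertex, Fin.le_last, mul_comm]

/-- The staircase function in the coordinates of `Q`. -/
noncomputable def staircaseQ {d n : ℕ} (a : Fin d → Fin (n + 1) → ℝ) (φ : (Fin d → ℝ) → ℝ)
    (ω : DirectionVector d n) (s : Fin d → Fin (n + 1) → ℝ) : ℝ :=
  φ (gridValue a (ω.point 0)) +
    ∑ t : Fin (d * n), (φ (gridValue a (ω.point (t + 1))) - φ (gridValue a (ω.point t))) *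
      ((s (ω.1 t) (ω.point (t + 1) (ω.1 t)) - s (ω.1 t) (ω.point t (ω.1 t))) /
        (a (ω.1 t) (ω.point (t + 1) (ω.1 t)) - a (ω.1 t) (ω.point t (ω.1 t))))

/-- Between adjacent coordinates `v_{ij}` increases only if `j` has reached the second one, so
differences in `Q` recover tail sums up to the factor divided out in `staircaseQ`. -/
theorem lamToQ_sub {d n : ℕ} (a : Fin d → Fin (n + 1) → ℝ) (l : Fin d → Fin (n + 1) → ℝ)
    (i : Fin d) (x y : Fin (n + 1)) (h : (y : ℕ) = x + 1) :
    lamToQ a l i y - lamToQ a l i x = (a i y - a i x) * tailSum l i y := by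
  simp only [lamToQ, Finset.sum_apply, Pi.smul_apply, simplexVertex, smul_eq_mul, tailSum,
    Finset.mul_sum]
  rw [← Finset.sum_sub_distrib]
  refine Finset.sum_congr rfl fun j _ => ?_
  split_ifs with hj
  · have h1 : min y j = y := min_eq_left (Fin.le_def.2 hj)
    have h2 : min x j = x := min_eq_left (Fin.le_def.2 (by omega))
    rw [h1, h2]
    ring
  · have h1 : min y j = j := min_eq_right (Fin.le_def.2 (by omega))
    have h2 : min x j = j := min_eq_right (Fin.le_def.2 (by omega))
    rw [h1, h2]
    ring

theorem staircaseQ_lamToQ {d n : ℕ} {a : Fin d → Fin (n + 1) → ℝ} (ha : ∀ i, StrictMono (a i))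
    (φ : (Fin d → ℝ) → ℝ) (ω : DirectionVector d n) (l : Fin d → Fin (n + 1) → ℝ) :
    staircaseQ a φ ω (lamToQ a l) = staircaseFn a φ ω l := by
  rw [staircaseFn_eq, staircaseQ]
  congr 1
  refine Finset.sum_congr rfl fun t _ => ?_
  have hs := ω.point_succ_self t
  rw [lamToQ_sub a l _ _ _ hs, mul_div_cancel_left₀]
  exact (sub_pos.2 (ha _ (Fin.lt_def.2 (by omega)))).ne'

theorem concaveOn_staircaseQ {d n : ℕ} (a : Fin d → Fin (n + 1) → ℝ) (φ : (Fin d → ℝ) → ℝ)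
    (ω : DirectionVector d n) : ConcaveOn ℝ (polytopeQ a) (staircaseQ a φ ω) := by
  refine ⟨convex_pi fun i _ => convex_convexHull ℝ _, fun x _ y _ α β _ _ h => le_of_eq ?_⟩
  simp only [staircaseQ, smul_eq_mul, mul_add, Finset.mul_sum, Pi.add_apply, Pi.smul_apply]
  rw [add_add_add_comm, ← add_mul, h, one_mul, ← Finset.sum_add_distrib]
  congr 1
  refine Finset.sum_congr rfl fun t _ => ?_
  ring

theorem extremePoints_polytopeQ_subset {d n : ℕ} (a : Fin d → Fin (n + 1) → ℝ) :
    Set.extremePoints ℝ (polytopeQ a) ⊆ Set.range fun p => lamToQ a (lamVertex p) := by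
  intro s hs
  rw [polytopeQ, extremePoints_pi] at hs
  choose p hp using fun i => extremePoints_convexHull_subset (hs i trivial)
  refine ⟨p, ?_⟩
  ext1 i
  simp [← hp i, lamToQ, lamVertex]

/-- A staircase function of a supermodular and vertex-extendable function is a majorant. -/
theorem le_staircaseFn {d n : ℕ} {a : Fin d → Fin (n + 1) → ℝ}
    (ha : ∀ i, StrictMono (a i)) {φ : (Fin d → ℝ) → ℝ} (hφ : SupermodularOver (box a) φ)
    (hext : ConcaveExtendable (polytopeQ a) (Set.extremePoints ℝ (polytopeQ a))
      (liftLast (n := n) φ))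
    (ω : DirectionVector d n) {l : Fin d → Fin (n + 1) → ℝ} (hl : l ∈ Lam d n) :
    φ (mapA a l) ≤ staircaseFn a φ ω l := by
  have hQ := lamToQ_mem a hl
  have h1 : ((φ (mapA a l) : ℝ) : EReal) ≤
      concEnv (polytopeQ a) (polytopeQ a) (liftLast φ) (lamToQ a l) := by
    refine le_iInf₂ fun h hh => ?_
    rw [← liftLast_lamToQ a φ l]
    exact EReal.coe_le_coe_iff.2 (hh.2 _ hQ)
  -- From here on a concave majorant need only be checked at the vertices of `Q`.
  rw [hext _ hQ] at h1
  have hmem : ∀ s ∈ Set.extremePoints ℝ (polytopeQ a), liftLast φ s ≤ staircaseQ a φ ω s := by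
    intro s hs
    obtain ⟨p, rfl⟩ := extremePoints_polytopeQ_subset a hs
    simp only [liftLast_lamToQ, staircaseQ_lamToQ ha, mapA_lamVertex]
    exact le_staircaseFn_lamVertex ha hφ ω p
  have h2 := h1.trans (iInf₂_le (staircaseQ a φ ω) ⟨concaveOn_staircaseQ a φ ω, hmem⟩)
  rw [staircaseQ_lamToQ ha] at h2
  exact EReal.coe_le_coe_iff.1 h2

/-! ### Lower bound: decomposition along a sorted staircase. -/

theorem sum_mul_sub_range (N : ℕ) (ζ F : ℕ → ℝ) :
    ∑ t ∈ Finset.range (N + 1), (ζ t - ζ (t + 1)) * F t =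
      ζ 0 * F 0 + ∑ t ∈ Finset.range N, ζ (t + 1) * (F (t + 1) - F t) - ζ (N + 1) * F N := by
  induction N with
  | zero => simp; ring
  | succ N ih => rw [Finset.sum_range_succ, ih, Finset.sum_range_succ _ N]; ring

/-- Along some staircase, the tail sums of a point of `Λ` are nonincreasing. -/
theorem exists_directionVector_antitone {d n : ℕ} {l : Fin d → Fin (n + 1) → ℝ}
    (hl : l ∈ Lam d n) : ∃ ω : DirectionVector d n,
      Antitone fun t : Fin (d * n) => tailSum l (ω.1 t) (ω.point (t + 1) (ω.1 t)) := by
  let e : Fin (d * n) ≃ Fin d × Fin n := finProdFinEquiv.symm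
  -- The pair `(i, j)` stands for the move from `j` to `j + 1` in direction `i`. Ties are broken by
  -- `j`, so that moves in one direction come in their natural order even where tail sums coincide.
  let g : Fin (d * n) → ℝ ×ₗ ℕ := fun u =>
    toLex (-tailSum l (e u).1 ((e u).2 + 1), ((e u).2 : ℕ))
  let c : Fin (d * n) ≃ Fin d × Fin n := (Tuple.sort g).trans e
  have hc : Monotone fun t : Fin (d * n) =>
      (toLex (-tailSum l (c t).1 ((c t).2 + 1), ((c t).2 : ℕ)) : ℝ ×ₗ ℕ) :=
    Tuple.monotone_sort g
  have hcard : ∀ (i : Fin d) (P : Fin n → Prop) [DecidablePred P],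
      (Finset.univ.filter fun t => (c t).1 = i ∧ P (c t).2).card =
        (Finset.univ.filter P).card := by
    intro i P _
    refine Finset.card_bij (fun t _ => (c t).2) ?_ ?_ ?_
    · intro t ht
      simpa using (Finset.mem_filter.1 ht).2.2
    · intro t ht t' ht' h
      exact c.injective (Prod.ext
        ((Finset.mem_filter.1 ht).2.1.trans (Finset.mem_filter.1 ht').2.1.symm) h)
    · intro j hj
      exact ⟨c.symm (i, j), by simpa using hj, by simp⟩
  let ω : DirectionVector d n := ⟨fun t => (c t).1, fun i => by
    simpa using hcard i fun _ => True⟩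
  have hpt : ∀ t : Fin (d * n), (ω.point (t + 1) (ω.1 t) : ℕ) = (c t).2 + 1 := by
    intro t
    have h1 : (Finset.univ.filter fun t' : Fin (d * n) => (t' : ℕ) < t + 1 ∧ ω.1 t' = ω.1 t) =
        Finset.univ.filter fun t' => (c t').1 = (c t).1 ∧ (c t').2 ≤ (c t).2 := by
      ext t'
      simp only [Finset.mem_filter, Finset.mem_univ, true_and, Nat.lt_succ_iff]
      rw [and_comm]
      refine and_congr_right fun h => ?_
      have h' : (c t').1 = (c t).1 := h
      constructor
      · intro hle
        have := hc (Fin.le_def.2 hle)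
        simp only [Prod.Lex.toLex_le_toLex, h'] at this
        rcases this with h2 | h2
        · by_contra hlt
          have := tailSum_antitone hl (c t).1
            (show ((c t).2 : ℕ) + 1 ≤ (c t').2 + 1 by
              have := Fin.lt_def.1 (not_le.1 hlt); omega)
          linarith
        · exact Fin.le_def.2 h2.2
      · intro hle
        by_contra hlt
        have hlt' : t < t' := Fin.lt_def.2 (not_le.1 hlt)
        have h3 := hc hlt'.le
        have h4 := tailSum_antitone hl (c t).1
            (show ((c t').2 : ℕ) + 1 ≤ (c t).2 + 1 by
              have := Fin.le_def.1 hle; omega)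
        simp only [Prod.Lex.toLex_le_toLex, h'] at h3
        have h5 : (c t).2 ≤ (c t').2 := by
          rcases h3 with h3 | h3
          · linarith
          · exact Fin.le_def.2 h3.2
        exact hlt'.ne' (c.injective (Prod.ext h' (le_antisymm hle h5)))
    change (Finset.univ.filter fun t' : Fin (d * n) =>
      (t' : ℕ) < t + 1 ∧ ω.1 t' = ω.1 t).card = _
    rw [h1, hcard (c t).1 (fun j => j ≤ (c t).2)]
    have : (Finset.univ.filter fun j => j ≤ (c t).2) = Finset.Iic (c t).2 := by
      ext; simp
    rw [this, Fin.card_Iic]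
  refine ⟨ω, fun t t' h => ?_⟩
  simp only [hpt]
  have := hc h
  simp only [Prod.Lex.toLex_le_toLex] at this
  change tailSum l (c t').1 _ ≤ tailSum l (c t).1 _
  rcases this with h2 | h2
  · linarith
  · linarith [h2.1]

/-- A point of `Λ` is a convex combination of the vertices on a staircase, and the staircase
functions have there the corresponding convex combination as value. -/
theorem exists_staircase_decomposition {d n : ℕ} {l : Fin d → Fin (n + 1) → ℝ}
    (hl : l ∈ Lam d n) : ∃ (ω : DirectionVector d n) (w : ℕ → ℝ), (∀ t, 0 ≤ w t) ∧
      ∑ t ∈ Finset.range (d * n + 1), w t = 1 ∧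
      l = ∑ t ∈ Finset.range (d * n + 1), w t • lamVertex (ω.point t) ∧
      ∀ (a : Fin d → Fin (n + 1) → ℝ) (φ : (Fin d → ℝ) → ℝ), staircaseFn a φ ω l =
        ∑ t ∈ Finset.range (d * n + 1), w t * φ (gridValue a (ω.point t)) := by
  obtain ⟨ω, hω⟩ := exists_directionVector_antitone hl
  let z : Fin (d * n) → ℝ := fun t => tailSum l (ω.1 t) (ω.point (t + 1) (ω.1 t))
  -- The sequence `1, z_0, z_1, …, 0` is nonincreasing; its successive drops are the weights.
  let ζ : ℕ → ℝ := fun t => if t = 0 then 1 else if h : t - 1 < d * n then z ⟨t - 1, h⟩ else 0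
  have hζ0 : ζ 0 = 1 := by simp [ζ]
  have hζs : ∀ t : Fin (d * n), ζ (t + 1) = z t := fun t => by simp [ζ]
  have hζN : ζ (d * n + 1) = 0 := by simp [ζ]
  have hz0 : ∀ t, 0 ≤ z t := fun t => tailSum_nonneg hl _ _
  have hz1 : ∀ t, z t ≤ 1 := fun t =>
    (tailSum_antitone hl _ (Nat.zero_le _)).trans_eq (tailSum_zero hl _)
  have hanti : ∀ t, 0 ≤ ζ t - ζ (t + 1) := by
    intro t
    rcases Nat.lt_or_ge t (d * n) with h | h
    · have h1 := hζs ⟨t, h⟩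
      simp only at h1
      rw [h1]
      rcases Nat.eq_zero_or_pos t with rfl | ht
      · rw [hζ0]
        linarith [hz1 ⟨0, h⟩]
      · obtain ⟨u, rfl⟩ : ∃ u, t = u + 1 := ⟨t - 1, by omega⟩
        have h2 := hζs ⟨u, by omega⟩
        simp only at h2
        rw [h2]
        exact sub_nonneg.2 (hω (Fin.le_def.2 (Nat.le_succ u)))
    · have h1 : ζ (t + 1) = 0 := by simp [ζ, h]
      rw [h1, sub_zero]
      simp only [ζ]
      split_ifs
      exacts [zero_le_one, hz0 _, le_rfl]
  have habel : ∀ F : ℕ → ℝ, ∑ t ∈ Finset.range (d * n + 1), (ζ t - ζ (t + 1)) * F t =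
      F 0 + ∑ t : Fin (d * n), (F (t + 1) - F t) * z t := by
    intro F
    rw [sum_mul_sub_range, hζ0, hζN,
      ← Fin.sum_univ_eq_sum_range (fun t => ζ (t + 1) * (F (t + 1) - F t))]
    simp only [hζs, mul_comm (z _)]
    ring
  refine ⟨ω, fun t => ζ t - ζ (t + 1), hanti, ?_, ?_, ?_⟩
  · simpa using habel fun _ => 1
  · ext i j
    simp only [Finset.sum_apply, Pi.smul_apply, smul_eq_mul]
    rw [habel fun t => lamVertex (ω.point t) i j]
    -- A potential for telescoping: arriving at `j` adds the tail sum from `j`, leaving it subtracts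
    -- the tail sum from `j + 1`, and `l i j` remains.
    let H : ℕ → ℝ := fun m => if m < j then 0 else if m = j then tailSum l i j else l i j
    have hH0 : lamVertex (ω.point 0) i j = H 0 := by
      simp only [lamVertex, ω.point_zero, H]
      rcases Nat.eq_zero_or_pos (j : ℕ) with h | h
      · have : j = 0 := Fin.ext h
        subst this
        simp [tailSum_zero hl]
      · have : (0 : Fin (n + 1)) ≠ j := fun h' => by simp [← h'] at h
        simp [h, this]
    have hstep : ∀ t : Fin (d * n),
        (lamVertex (ω.point (t + 1)) i j - lamVertex (ω.point t) i j) * z t =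
          H (ω.point (t + 1) i) - H (ω.point t i) := by
      intro t
      by_cases hi : ω.1 t = i
      · subst hi
        have hs := ω.point_succ_self t
        have hz : z t = tailSum l (ω.1 t) (ω.point t (ω.1 t) + 1) := by simp only [z, hs]
        have htl := tailSum_sub_tailSum_succ l (ω.1 t) j
        rw [hz]
        simp only [lamVertex, H, Fin.ext_iff, hs]
        rcases lt_trichotomy (ω.point t (ω.1 t) : ℕ) j with h | h | h
        · by_cases h' : (ω.point t (ω.1 t) : ℕ) + 1 = j
          · simp [h', h, h.ne]
          · have : (ω.point t (ω.1 t) : ℕ) + 1 < j := by omega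
            simp [h', h, h.ne, this]
        · simp [h]
          linarith
        · have h1 : ¬ (ω.point t (ω.1 t) : ℕ) + 1 < j := by omega
          have h2 : (ω.point t (ω.1 t) : ℕ) + 1 ≠ j := by omega
          simp [h.not_gt, h.ne', h1, h2]
      · simp [lamVertex, ω.point_succ_of_ne t hi]
    simp only [hstep]
    rw [hH0, Fin.sum_univ_eq_sum_range (fun t => H (ω.point (t + 1) i) - H (ω.point t i)),
      Finset.sum_range_sub (fun t => H (ω.point t i)), ω.point_last, ω.point_zero]
    have hn : H (Fin.last n) = l i j := by
      simp only [H, Fin.val_last]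
      rw [if_neg (by omega)]
      split_ifs with h
      · rw [← tailSum_sub_tailSum_succ l i j, eq_comm, sub_eq_self, ← h]
        exact Finset.sum_eq_zero fun x _ => if_neg (by omega)
      · rfl
    rw [hn]
    simp
  · intro a φ
    rw [habel fun t => φ (gridValue a (ω.point t)), staircaseFn_eq]

/-- The concave envelope over `Λ` is at least any convex combination of values at vertices. -/
theorem le_concEnv_of_decomposition {d n : ℕ} {a : Fin d → Fin (n + 1) → ℝ}
    (φ : (Fin d → ℝ) → ℝ) {ι : Type*} (s : Finset ι) (w : ι → ℝ)
    (p : ι → Fin d → Fin (n + 1)) (hw : ∀ t ∈ s, 0 ≤ w t) (hw1 : ∑ t ∈ s, w t = 1)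
    {l : Fin d → Fin (n + 1) → ℝ} (hl : l = ∑ t ∈ s, w t • lamVertex (p t)) :
    ((∑ t ∈ s, w t * φ (gridValue a (p t)) : ℝ) : EReal) ≤
      concEnv (Lam d n) (Lam d n) (fun l' => φ (mapA a l')) l := by
  refine le_iInf₂ fun h hh => EReal.coe_le_coe_iff.2 ?_
  rw [hl]
  refine le_trans ?_ (hh.1.le_map_sum hw hw1 fun t _ => lamVertex_mem (p t))
  refine Finset.sum_le_sum fun t ht => mul_le_mul_of_nonneg_left ?_ (hw t ht)
  rw [← mapA_lamVertex]
  exact hh.2 _ (lamVertex_mem _)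

theorem staircaseFn_combo {d n : ℕ} (a : Fin d → Fin (n + 1) → ℝ) (φ : (Fin d → ℝ) → ℝ)
    (ω : DirectionVector d n) (x y : Fin d → Fin (n + 1) → ℝ) {α β : ℝ} (h : α + β = 1) :
    staircaseFn a φ ω (α • x + β • y) = α * staircaseFn a φ ω x + β * staircaseFn a φ ω y := by
  have ht : ∀ i m, tailSum (α • x + β • y) i m = α * tailSum x i m + β * tailSum y i m := by
    intro i m
    simp only [tailSum, Finset.mul_sum]
    rw [← Finset.sum_add_distrib]
    refine Finset.sum_congr rfl fun j _ => ?_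
    split_ifs <;> simp
  simp only [staircaseFn_eq, ht, mul_add, Finset.mul_sum]
  rw [add_add_add_comm, ← add_mul, h, one_mul, ← Finset.sum_add_distrib]
  congr 1
  refine Finset.sum_congr rfl fun t _ => ?_
  ring

theorem convex_Lam (d n : ℕ) : Convex ℝ (Lam d n) :=
  convex_pi fun _ _ => convex_stdSimplex ℝ _

theorem concEnv_le_staircaseFn {d n : ℕ} {a : Fin d → Fin (n + 1) → ℝ}
    (ha : ∀ i, StrictMono (a i)) {φ : (Fin d → ℝ) → ℝ} (hφ : SupermodularOver (box a) φ)
    (hext : ConcaveExtendable (polytopeQ a) (Set.extremePoints ℝ (polytopeQ a))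
      (liftLast (n := n) φ))
    (ω : DirectionVector d n) (l : Fin d → Fin (n + 1) → ℝ) :
    concEnv (Lam d n) (Lam d n) (fun l' => φ (mapA a l')) l ≤ (staircaseFn a φ ω l : EReal) :=
  iInf₂_le (staircaseFn a φ ω) ⟨⟨convex_Lam d n, fun x _ y _ _ _ _ _ h =>
    (staircaseFn_combo a φ ω x y h).ge⟩, fun _ hy => le_staircaseFn ha hφ hext ω hy⟩

/-- All staircase functions are concave majorants; the one sorted for `l` attains the envelope at
`l`. -/
theorem isLeast_concEnv {d n : ℕ} {a : Fin d → Fin (n + 1) → ℝ}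
    (ha : ∀ i, StrictMono (a i)) {φ : (Fin d → ℝ) → ℝ} (hφ : SupermodularOver (box a) φ)
    (hext : ConcaveExtendable (polytopeQ a) (Set.extremePoints ℝ (polytopeQ a))
      (liftLast (n := n) φ)) {l : Fin d → Fin (n + 1) → ℝ} (hl : l ∈ Lam d n) :
    IsLeast (Set.range fun ω : DirectionVector d n => ((staircaseFn a φ ω l : ℝ) : EReal))
      (concEnv (Lam d n) (Lam d n) (fun l' => φ (mapA a l')) l) := by
  obtain ⟨ω, w, hw, hw1, hdec, hst⟩ := exists_staircase_decomposition hl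
  refine ⟨⟨ω, le_antisymm ?_ (concEnv_le_staircaseFn ha hφ hext ω l)⟩, ?_⟩
  · dsimp only
    rw [hst a φ]
    exact le_concEnv_of_decomposition φ _ w _ (fun t _ => hw t) hw1 hdec
  · rintro _ ⟨ω', rfl⟩
    exact concEnv_le_staircaseFn ha hφ hext ω' l

/-! ### Polyhedra -/

section Polyhedra

variable {E : Type*} [AddCommGroup E] [Module ℝ E]

theorem isPolyhedron_of_finite {ι : Type*} [Finite ι] (ℓ : ι → E →ₗ[ℝ] ℝ) (b : ι → ℝ) :
    IsPolyhedron {x | ∀ i, ℓ i x ≤ b i} := by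
  obtain ⟨m, ⟨e⟩⟩ := Finite.exists_equiv_fin ι
  refine ⟨m, fun i => ℓ (e.symm i), fun i => b (e.symm i), ?_⟩
  ext x
  exact ⟨fun h i => h _, fun h i => by simpa using h (e i)⟩

theorem IsPolyhedron.setOf_forall {ι : Type*} [Finite ι] {P : ι → E → Prop}
    (h : ∀ i, IsPolyhedron {x | P i x}) : IsPolyhedron {x | ∀ i, P i x} := by
  choose m ℓ b hb using h
  convert isPolyhedron_of_finite (fun s : Σ i, Fin (m i) => ℓ s.1 s.2) (fun s => b s.1 s.2)
    using 1
  ext x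
  have : ∀ i, P i x ↔ ∀ j, ℓ i j x ≤ b i j := fun i => Set.ext_iff.1 (hb i) x
  simp [this, Sigma.forall]

theorem IsPolyhedron.setOf_and {P Q : E → Prop} (hP : IsPolyhedron {x | P x})
    (hQ : IsPolyhedron {x | Q x}) : IsPolyhedron {x | P x ∧ Q x} := by
  have := IsPolyhedron.setOf_forall (P := fun (c : Bool) x => if c then P x else Q x)
    fun c => by cases c <;> simpa
  simpa [Bool.forall_bool, and_comm] using this

theorem IsPolyhedron.convex {R : Set E} (hR : IsPolyhedron R) : Convex ℝ R := by
  obtain ⟨m, ℓ, b, rfl⟩ := hR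
  simp only [Set.ofPred_forall]
  exact convex_iInter fun i => convex_halfSpace_le (ℓ i).isLinear (b i)

/-- A function that is the sum of a linear functional and a constant. -/
def IsAffineFn (f : E → ℝ) : Prop :=
  ∃ (ℓ : E →ₗ[ℝ] ℝ) (c : ℝ), ∀ x, f x = ℓ x + c

theorem isAffineFn_const (c : ℝ) : IsAffineFn fun _ : E => c := ⟨0, c, by simp⟩

theorem IsLinearMap.isAffineFn {f : E → ℝ} (hf : IsLinearMap ℝ f) : IsAffineFn f :=
  ⟨hf.mk' f, 0, by simp⟩

theorem IsAffineFn.add {f g : E → ℝ} (hf : IsAffineFn f) (hg : IsAffineFn g) :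
    IsAffineFn fun x => f x + g x := by
  obtain ⟨ℓ, c, h⟩ := hf
  obtain ⟨ℓ', c', h'⟩ := hg
  exact ⟨ℓ + ℓ', c + c', fun x => by simp [h, h']; ring⟩

theorem IsAffineFn.const_mul {f : E → ℝ} (hf : IsAffineFn f) (r : ℝ) :
    IsAffineFn fun x => r * f x := by
  obtain ⟨ℓ, c, h⟩ := hf
  exact ⟨r • ℓ, r * c, fun x => by simp [h]; ring⟩

theorem IsAffineFn.sub {f g : E → ℝ} (hf : IsAffineFn f) (hg : IsAffineFn g) :
    IsAffineFn fun x => f x - g x := by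
  simpa [sub_eq_add_neg] using hf.add (hg.const_mul (-1))

theorem IsAffineFn.sum {ι : Type*} (s : Finset ι) {f : ι → E → ℝ}
    (hf : ∀ i, IsAffineFn (f i)) : IsAffineFn fun x => ∑ i ∈ s, f i x := by
  choose ℓ c h using hf
  exact ⟨∑ i ∈ s, ℓ i, ∑ i ∈ s, c i, fun x => by simp [h, Finset.sum_add_distrib]⟩

theorem IsAffineFn.isPolyhedron_le {f g : E → ℝ} (hf : IsAffineFn f) (hg : IsAffineFn g) :
    IsPolyhedron {x | f x ≤ g x} := by
  obtain ⟨ℓ, c, h⟩ := hf.sub hg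
  convert isPolyhedron_of_finite (fun _ : Unit => ℓ) (fun _ => -c) using 1
  ext x
  have := h x
  simp only [Set.mem_ofPred_eq, forall_const]
  constructor <;> intro <;> linarith

theorem IsAffineFn.isPolyhedron_eq {f g : E → ℝ} (hf : IsAffineFn f) (hg : IsAffineFn g) :
    IsPolyhedron {x | f x = g x} := by
  simpa only [le_antisymm_iff] using (hf.isPolyhedron_le hg).setOf_and (hg.isPolyhedron_le hf)

end Polyhedra

/-- Points of weight zero may lie outside `S`; a staircase does leave the subcube at such points. -/
theorem sum_smul_mem_convexHull {E ι : Type*} [AddCommGroup E] [Module ℝ E] {S : Set E}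
    (s : Finset ι) (w : ι → ℝ) (z : ι → E) (hw : ∀ t ∈ s, 0 ≤ w t) (hw1 : ∑ t ∈ s, w t = 1)
    (hz : ∀ t ∈ s, w t ≠ 0 → z t ∈ S) : ∑ t ∈ s, w t • z t ∈ convexHull ℝ S := by
  rw [← Finset.sum_filter_of_ne (p := fun t => w t ≠ 0)
    fun t _ h h0 => h (by rw [h0, zero_smul])]
  refine (convex_convexHull ℝ S).sum_mem (fun t ht => hw t (Finset.mem_filter.1 ht).1) ?_
    fun t ht => subset_convexHull ℝ S
      (hz t (Finset.mem_filter.1 ht).1 (Finset.mem_filter.1 ht).2)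
  rw [Finset.sum_filter_ne_zero, hw1]

/-! ### The relaxation -/

theorem sum_lamVertex {d n : ℕ} (p : Fin d → Fin (n + 1)) (i : Fin d)
    (S : Finset (Fin (n + 1))) : ∑ j ∈ S, lamVertex p i j = if p i ∈ S then 1 else 0 := by
  simp [lamVertex]

theorem mem_codeSet {n m : ℕ} {η : ℕ → Fin m → Bool} {b : Bool} {k : Fin m}
    {j : Fin (n + 1)} :
    j ∈ codeSet n η b k ↔ grayExt n η j k = b ∨ grayExt n η (j + 1) k = b := by
  simp only [codeSet, Finset.mem_filter, Finset.mem_univ, true_and]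

/-- This keeps the lower bound on `δ` at most the upper one at each vertex of `Λ`. -/
theorem mem_codeSet_true_or_false (n : ℕ) {m : ℕ} (η : ℕ → Fin m → Bool) (k : Fin m)
    (j : Fin (n + 1)) : j ∈ codeSet n η true k ∨ j ∈ codeSet n η false k := by
  simp only [mem_codeSet]
  cases grayExt n η j k <;> simp

instance {d n : ℕ} : Finite (DirectionVector d n) :=
  inferInstanceAs (Finite {ω : Fin (d * n) → Fin d //
    ∀ i, (Finset.univ.filter fun t => ω t = i).card = n})

section Relaxation

variable {d n κ : ℕ} {a : Fin d → Fin (n + 1) → ℝ} {θ : (Fin d → ℝ) → Fin κ → ℝ}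
  {η : Fin d → ℕ → Fin (Nat.clog 2 n) → Bool}

theorem mem_envelopeRelaxation_iff (ha : ∀ i, StrictMono (a i))
    (hsuper : ∀ k, SupermodularOver (box a) (fun f => θ f k))
    (hext : ∀ k, ConcaveExtendable (polytopeQ a) (Set.extremePoints ℝ (polytopeQ a))
      (liftLast (n := n) (fun f => θ f k)))
    (p : ((Fin d → ℝ) × (Fin κ → ℝ)) × LamSpace d n × (BinIdx d n → ℝ)) :
    p ∈ envelopeRelaxation a θ η ↔
      (∀ k (ω : DirectionVector d n), p.1.2 k ≤ staircaseFn a (fun f => θ f k) ω p.2.1) ∧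
        (∀ i, p.1.1 i = mapA a p.2.1 i) ∧
        ∀ i, LogSOS2 (η i) (p.2.1 i) (fun k => p.2.2 (i, k)) := by
  -- The SOS2 part supplies `λ ∈ Λ`, without which the formula for the envelope is not available.
  simp only [envelopeRelaxation, Set.mem_ofPred_eq, funext_iff]
  refine and_congr_left fun h => forall_congr' fun k => ?_
  have hl := isLeast_concEnv ha (hsuper k) (hext k) (l := p.2.1) fun i _ => (h.2 i).1
  constructor
  · intro hk ω
    exact EReal.coe_le_coe_iff.1 (hk.trans (hl.2 ⟨ω, rfl⟩))
  · intro hk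
    obtain ⟨ω, hω⟩ := hl.1
    rw [← hω]
    exact EReal.coe_le_coe_iff.2 (hk ω)

theorem isPolyhedron_envelopeRelaxation (ha : ∀ i, StrictMono (a i))
    (hsuper : ∀ k, SupermodularOver (box a) (fun f => θ f k))
    (hext : ∀ k, ConcaveExtendable (polytopeQ a) (Set.extremePoints ℝ (polytopeQ a))
      (liftLast (n := n) (fun f => θ f k))) :
    IsPolyhedron (envelopeRelaxation a θ η) := by
  let E := ((Fin d → ℝ) × (Fin κ → ℝ)) × LamSpace d n × (BinIdx d n → ℝ)
  have hf : ∀ i, IsAffineFn fun p : E => p.1.1 i := fun i =>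
    IsLinearMap.isAffineFn ⟨fun _ _ => rfl, fun _ _ => rfl⟩
  have hθ : ∀ k, IsAffineFn fun p : E => p.1.2 k := fun k =>
    IsLinearMap.isAffineFn ⟨fun _ _ => rfl, fun _ _ => rfl⟩
  have hl : ∀ i j, IsAffineFn fun p : E => p.2.1 i j := fun i j =>
    IsLinearMap.isAffineFn ⟨fun _ _ => rfl, fun _ _ => rfl⟩
  have hδ : ∀ b, IsAffineFn fun p : E => p.2.2 b := fun b =>
    IsLinearMap.isAffineFn ⟨fun _ _ => rfl, fun _ _ => rfl⟩
  have hst : ∀ φ (ω : DirectionVector d n), IsAffineFn fun p : E => staircaseFn a φ ω p.2.1 :=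
    fun φ ω => (isAffineFn_const _).add (IsAffineFn.sum _ fun i => IsAffineFn.sum _ fun t =>
      (IsAffineFn.sum _ fun j => hl i j).const_mul _)
  have hA : ∀ i, IsAffineFn fun p : E => mapA a p.2.1 i := fun i =>
    IsAffineFn.sum _ fun j => (hl i j).const_mul _
  have : envelopeRelaxation a θ η = {p | _} :=
    Set.ext (mem_envelopeRelaxation_iff (η := η) ha hsuper hext)
  rw [this]
  refine .setOf_and (.setOf_forall fun k => .setOf_forall fun ω =>
    (hθ k).isPolyhedron_le (hst _ ω)) (.setOf_and (.setOf_forall fun i =>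
      (hf i).isPolyhedron_eq (hA i)) (.setOf_forall fun i => .setOf_and (.setOf_and
        (.setOf_forall fun j => (isAffineFn_const 0).isPolyhedron_le (hl i j))
        ((IsAffineFn.sum _ fun j => hl i j).isPolyhedron_eq (isAffineFn_const 1)))
        (.setOf_forall fun k => .setOf_and
          ((IsAffineFn.sum _ fun j => hl i j).isPolyhedron_le (hδ (i, k)))
          ((hδ (i, k)).isPolyhedron_le
            ((isAffineFn_const 1).sub (IsAffineFn.sum _ fun j => hl i j))))))

/-! ### Extreme points of the relaxation. -/

theorem exists_interpolation {lo up δ : ℝ} (h1 : lo ≤ δ) (h2 : δ ≤ up) :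
    ∃ r : ℝ, 0 ≤ r ∧ r ≤ 1 ∧ δ = (1 - r) * lo + r * up := by
  have : δ ∈ segment ℝ lo up := by
    rw [segment_eq_Icc (h1.trans h2)]
    exact ⟨h1, h2⟩
  obtain ⟨α, β, hα, hβ, hαβ, h⟩ := this
  refine ⟨β, hβ, by linarith, ?_⟩
  rw [← h, ← hαβ]
  simp

/-- At a vertex of the relaxation, `λ` is a vertex of `Λ`. -/
theorem exists_eq_lamVertex_of_mem_extremePoints (ha : ∀ i, StrictMono (a i))
    (hsuper : ∀ k, SupermodularOver (box a) (fun f => θ f k))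
    (hext : ∀ k, ConcaveExtendable (polytopeQ a) (Set.extremePoints ℝ (polytopeQ a))
      (liftLast (n := n) (fun f => θ f k)))
    {p : ((Fin d → ℝ) × (Fin κ → ℝ)) × LamSpace d n × (BinIdx d n → ℝ)}
    (hp : p ∈ Set.extremePoints ℝ (envelopeRelaxation a θ η)) :
    ∃ q : Fin d → Fin (n + 1), p.2.1 = lamVertex q := by
  obtain ⟨h1, h2, h3⟩ := (mem_envelopeRelaxation_iff ha hsuper hext p).1 hp.1
  obtain ⟨ω, w, hw, hw1, hdec, hst⟩ :=
    exists_staircase_decomposition (l := p.2.1) fun i _ => (h3 i).1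
  set T := Finset.range (d * n + 1)
  have hsum : ∀ (i : Fin d) (S : Finset (Fin (n + 1))), ∑ j ∈ S, p.2.1 i j =
      ∑ t ∈ T, w t * if ω.point t i ∈ S then 1 else 0 := by
    intro i S
    rw [hdec]
    simp only [Finset.sum_apply, Pi.smul_apply, smul_eq_mul]
    rw [Finset.sum_comm]
    simp only [← Finset.mul_sum, sum_lamVertex]
  -- The bounds on `δ_b` at the `t`-th grid point; their `w`-averages are the bounds at `p`.
  let lo : BinIdx d n → ℕ → ℝ := fun b t =>
    if ω.point t b.1 ∈ (codeSet n (η b.1) true b.2)ᶜ then 1 else 0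
  let up : BinIdx d n → ℕ → ℝ := fun b t =>
    1 - if ω.point t b.1 ∈ (codeSet n (η b.1) false b.2)ᶜ then 1 else 0
  have hlu : ∀ b t, lo b t ≤ up b t := by
    intro b t
    simp only [lo, up, Finset.mem_compl]
    rcases mem_codeSet_true_or_false n (η b.1) b.2 (ω.point t b.1) with h | h <;>
      simp only [h, not_true_eq_false, if_false] <;> split_ifs <;> norm_num
  have hr : ∀ b : BinIdx d n, ∃ r : ℝ, 0 ≤ r ∧ r ≤ 1 ∧
      p.2.2 b = (1 - r) * (∑ t ∈ T, w t * lo b t) + r * ∑ t ∈ T, w t * up b t := by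
    intro b
    have := (h3 b.1).2 b.2
    rw [hsum, hsum] at this
    refine exists_interpolation this.1 (this.2.trans_eq ?_)
    simp only [up, mul_sub, Finset.sum_sub_distrib, mul_one, hw1]
  choose r hr0 hr1 hr using hr
  -- Every grid point inherits the slack of `p` in the inequality of `ω` and the ratio `r b`, so
  -- that the `w`-average is exactly `p`.
  let P : ℕ → ((Fin d → ℝ) × (Fin κ → ℝ)) × LamSpace d n × (BinIdx d n → ℝ) := fun t =>
    ((gridValue a (ω.point t), fun k => θ (gridValue a (ω.point t)) k -
        (staircaseFn a (fun f => θ f k) ω p.2.1 - p.1.2 k)),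
      lamVertex (ω.point t), fun b => (1 - r b) * lo b t + r b * up b t)
  have hP : ∀ t, P t ∈ envelopeRelaxation a θ η := by
    intro t
    rw [mem_envelopeRelaxation_iff ha hsuper hext]
    refine ⟨fun k ω' => ?_, fun i => ?_, fun i => ⟨lamVertex_mem _ i trivial, fun k => ?_⟩⟩
    · have := le_staircaseFn_lamVertex ha (hsuper k) ω' (ω.point t)
      have := h1 k ω
      simp only [P]
      linarith
    · simp only [P, mapA_lamVertex]
    · simp only [P, sum_lamVertex]
      have hle := hlu (i, k) t
      have := hr0 (i, k)
      have := hr1 (i, k)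
      constructor
      · change lo (i, k) t ≤ _
        nlinarith
      · change _ ≤ up (i, k) t
        nlinarith
  have hpP : p = ∑ t ∈ T, w t • P t := by
    refine Prod.ext (Prod.ext ?_ ?_) (Prod.ext ?_ ?_)
    · ext i
      rw [h2 i]
      simp only [Prod.fst_sum, Finset.sum_apply, Prod.smul_fst, Pi.smul_apply, smul_eq_mul, P,
        ← mapA_lamVertex, mapA, Finset.mul_sum]
      rw [Finset.sum_comm]
      refine Finset.sum_congr rfl fun j _ => ?_
      conv_lhs => rw [hdec]
      simp only [Finset.sum_apply, Pi.smul_apply, smul_eq_mul, Finset.mul_sum]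
      exact Finset.sum_congr rfl fun t _ => by ring
    · ext k
      simp only [Prod.fst_sum, Prod.snd_sum, Finset.sum_apply, Prod.smul_fst, Prod.smul_snd,
        Pi.smul_apply, smul_eq_mul, P]
      have := hst a fun f => θ f k
      simp only [mul_sub (w _) (θ _ k), Finset.sum_sub_distrib, ← Finset.sum_mul, hw1,
        ← this]
      ring
    · simpa only [Prod.fst_sum, Prod.snd_sum, Prod.smul_fst, Prod.smul_snd, P] using hdec
    · ext b
      simp only [Prod.snd_sum, Finset.sum_apply, Prod.smul_snd,
        Pi.smul_apply, smul_eq_mul, P]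
      rw [hr b, Finset.mul_sum, Finset.mul_sum, ← Finset.sum_add_distrib]
      exact Finset.sum_congr rfl fun t _ => by ring
  have hconv : convexHull ℝ (Set.range P) ⊆ envelopeRelaxation a θ η :=
    convexHull_min (Set.range_subset_iff.2 hP)
      (isPolyhedron_envelopeRelaxation ha hsuper hext).convex
  have hmem : p ∈ convexHull ℝ (Set.range P) := by
    rw [hpP]
    exact sum_smul_mem_convexHull T w P (fun t _ => hw t) hw1 fun t _ _ => ⟨t, rfl⟩
  obtain ⟨t, ht⟩ := extremePoints_convexHull_subset
    (inter_extremePoints_subset_extremePoints_of_subset hconv ⟨hmem, hp⟩)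
  exact ⟨ω.point t, by rw [← ht]⟩

theorem binary_of_mem_extremePoints (ha : ∀ i, StrictMono (a i))
    (hsuper : ∀ k, SupermodularOver (box a) (fun f => θ f k))
    (hext : ∀ k, ConcaveExtendable (polytopeQ a) (Set.extremePoints ℝ (polytopeQ a))
      (liftLast (n := n) (fun f => θ f k)))
    {p : ((Fin d → ℝ) × (Fin κ → ℝ)) × LamSpace d n × (BinIdx d n → ℝ)}
    (hp : p ∈ Set.extremePoints ℝ (envelopeRelaxation a θ η)) (b : BinIdx d n) :
    p.2.2 b = 0 ∨ p.2.2 b = 1 := by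
  obtain ⟨q, hq⟩ := exists_eq_lamVertex_of_mem_extremePoints ha hsuper hext hp
  obtain ⟨h1, h2, h3⟩ := hp.1
  have hb := (h3 b.1).2 b.2
  rw [hq, sum_lamVertex, sum_lamVertex] at hb
  simp only [Finset.mem_compl, Prod.mk.eta] at hb
  by_cases hL : q b.1 ∈ codeSet n (η b.1) true b.2
  swap
  · right
    rw [if_pos hL] at hb
    split_ifs at hb <;> linarith
  by_cases hR : q b.1 ∈ codeSet n (η b.1) false b.2
  swap
  · left
    rw [if_pos hR] at hb
    split_ifs at hb <;> linarith
  rw [if_neg (not_not.2 hL), if_neg (not_not.2 hR), sub_zero] at hb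
  by_contra! hne
  have h0 : 0 < p.2.2 b := lt_of_le_of_ne hb.1 hne.1.symm
  have hlt : p.2.2 b < 1 := lt_of_le_of_ne hb.2 hne.2
  -- The vertex index lies in both code sets, so `δ_b` may move freely in `[0, 1]`; a fractional
  -- value would put `p` inside a segment.
  let P : ℝ → ((Fin d → ℝ) × (Fin κ → ℝ)) × LamSpace d n × (BinIdx d n → ℝ) := fun c =>
    (p.1, p.2.1, Function.update p.2.2 b c)
  have hP : ∀ c : ℝ, 0 ≤ c → c ≤ 1 → P c ∈ envelopeRelaxation a θ η := by
    intro c hc0 hc1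
    refine ⟨h1, h2, fun i => ⟨(h3 i).1, fun k => ?_⟩⟩
    by_cases hik : (i, k) = b
    · subst hik
      simp only [P, Function.update_self, hq, sum_lamVertex, Finset.mem_compl]
      rw [if_neg (not_not.2 hL), if_neg (not_not.2 hR), sub_zero]
      exact ⟨hc0, hc1⟩
    · simp only [P, Function.update_of_ne hik]
      exact (h3 i).2 k
  have hseg : p ∈ openSegment ℝ (P 0) (P 1) := by
    refine ⟨1 - p.2.2 b, p.2.2 b, by linarith, h0, by ring, ?_⟩
    refine Prod.ext ?_ (Prod.ext ?_ ?_)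
    · simp [P, ← add_smul]
    · simp [P, ← add_smul]
    · ext b'
      by_cases hbb : b' = b
      · subst hbb
        simp [P]
      · simp [P, Function.update_of_ne hbb]
        ring
  have := hp.2 (hP 0 le_rfl zero_le_one) (hP 1 zero_le_one le_rfl) hseg
  have h := congrFun (congrArg (fun x => x.2.2) this) b
  simp only [P, Function.update_self] at h
  exact h0.ne h

end Relaxation

/-! ### The projection -/

theorem hammingDist_grayExt_le {n m : ℕ} {η : ℕ → Fin m → Bool} (hη : IsGrayCode n η) (j : ℕ) :
    hammingDist (grayExt n η j) (grayExt n η (j + 1)) ≤ 1 := by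
  simp only [grayExt]
  by_cases h : 1 ≤ j ∧ j + 1 ≤ n
  · have h1 : max 1 (min j n) = j := by omega
    have h2 : max 1 (min (j + 1) n) = j + 1 := by omega
    rw [h1, h2]
    exact hη.2 j h.1 h.2
  · have h1 : max 1 (min j n) = max 1 (min (j + 1) n) := by omega
    simp [h1]

/-- In each component at least one of the two words agrees with `b`. If both differed from `b`, they
would do so in different components and hence differ from each other in two. -/
theorem grayExt_eq_or_of_forall_mem_codeSet {n m : ℕ} {η : ℕ → Fin m → Bool}
    (hη : IsGrayCode n η) {b : Fin m → Bool} {j : Fin (n + 1)}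
    (h : ∀ k, j ∈ codeSet n η (b k) k) : grayExt n η j = b ∨ grayExt n η (j + 1) = b := by
  by_contra! hne
  obtain ⟨k, hk⟩ := Function.ne_iff.1 hne.1
  obtain ⟨k', hk'⟩ := Function.ne_iff.1 hne.2
  simp only [mem_codeSet] at h
  have h1 : grayExt n η (j + 1) k = b k := (h k).resolve_left hk
  have h2 : grayExt n η j k' = b k' := (h k').resolve_right hk'
  have hd := Finset.card_le_one.1 (hammingDist_grayExt_le hη j) k
    (by simpa [h1] using hk) k' (by simpa [h2] using hk'.symm)
  exact hk' (hd ▸ h1)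

/-- Indices that agree with one code word lie in one segment of the subdivision. -/
theorem exists_segment_of_codeSet {n m : ℕ} (hn : 1 ≤ n) {η : ℕ → Fin m → Bool}
    (hη : IsGrayCode n η) {b : Fin m → Bool} {S : Set (Fin (n + 1))} (hS : S.Nonempty)
    (h : ∀ j ∈ S, ∀ k, j ∈ codeSet n η (b k) k) :
    ∃ t : Fin n, ∀ j ∈ S, j = t.castSucc ∨ j = t.succ := by
  -- Word `c` belongs to the segment with ends `c - 1` and `c`, also after clamping at the two
  -- extremes. Injectivity then makes `c` the same for all `j`.
  have key : ∀ j ∈ S, ∃ c, 1 ≤ c ∧ c ≤ n ∧ η c = b ∧ ((j : ℕ) = c - 1 ∨ (j : ℕ) = c) := by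
    intro j hj
    have hjn := j.is_lt
    rcases grayExt_eq_or_of_forall_mem_codeSet hη (h j hj) with h1 | h1
    · exact ⟨max 1 (min j n), by omega, by omega, h1, by omega⟩
    · exact ⟨max 1 (min (j + 1) n), by omega, by omega, h1, by omega⟩
  obtain ⟨j₀, hj₀⟩ := hS
  obtain ⟨c, hc1, hcn, hcb, -⟩ := key j₀ hj₀
  refine ⟨⟨c - 1, by omega⟩, fun j hj => ?_⟩
  obtain ⟨c', hc1', hcn', hcb', hj'⟩ := key j hj
  have : c' = c := hη.1 ⟨hc1', hcn'⟩ ⟨hc1, hcn⟩ (hcb'.trans hcb.symm)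
  subst this
  simp only [Fin.ext_iff, Fin.val_castSucc, Fin.val_succ]
  omega

theorem castSucc_succ_mem_codeSet {n m : ℕ} (η : ℕ → Fin m → Bool) (t : Fin n) (k : Fin m) :
    t.castSucc ∈ codeSet n η (η (t + 1) k) k ∧ t.succ ∈ codeSet n η (η (t + 1) k) k := by
  have ht := t.is_lt
  have h : max 1 (min ((t : ℕ) + 1) n) = t + 1 := by omega
  rw [mem_codeSet, mem_codeSet, grayExt, grayExt]
  simp only [Fin.val_castSucc, Fin.val_succ, h, or_true, grayExt, true_or, and_self]

/-- Integral logarithmic SOS2 constraints confine `λ` to two adjacent components. -/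
theorem LogSOS2.exists_segment {n m : ℕ} (hn : 1 ≤ n) {η : ℕ → Fin m → Bool}
    (hη : IsGrayCode n η) {l : Fin (n + 1) → ℝ} {δ : Fin m → ℝ} (h : LogSOS2 η l δ)
    (hδ : ∀ k, δ k = 0 ∨ δ k = 1) :
    ∃ t : Fin n, ∀ j, l j ≠ 0 → j = t.castSucc ∨ j = t.succ := by
  obtain ⟨⟨hl0, hl1⟩, h⟩ := h
  have hzero : ∀ (S : Finset (Fin (n + 1))), ∑ j ∈ Sᶜ, l j ≤ 0 → ∀ j, l j ≠ 0 → j ∈ S := by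
    intro S hS j hj
    by_contra hjS
    have := Finset.single_le_sum (fun j _ => hl0 j) (Finset.mem_compl.2 hjS)
    exact hj (le_antisymm (this.trans hS) (hl0 j))
  -- The value `δ k = 0` annihilates `λ` off `L`, the set for bit `true`: binary `δ` is the
  -- complement of the code word.
  refine exists_segment_of_codeSet hn hη (b := fun k => decide (δ k = 0))
    (S := {j | l j ≠ 0}) ?_ ?_
  · by_contra hne
    have : ∀ j, l j = 0 := by
      intro j
      by_contra hj
      exact hne ⟨j, hj⟩
    simp [this] at hl1
  · intro j hj k
    have hk := h k
    rcases hδ k with h0 | h0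
    · simp only [h0, decide_true]
      exact hzero _ (by linarith) j hj
    · simp only [h0, one_ne_zero, decide_false]
      exact hzero _ (by linarith) j hj

/-! ### Lifting a point of a subcube, and the projection. -/

/-- The fraction of its edge of the subcube at which a point lies, in each coordinate. -/
noncomputable def subcubeFrac {d n : ℕ} (a : Fin d → Fin (n + 1) → ℝ) (t : Fin d → Fin n)
    (f : Fin d → ℝ) (i : Fin d) : ℝ :=
  (f i - a i (t i).castSucc) / (a i (t i).succ - a i (t i).castSucc)

/-- The `λ` supported on the vertices of a subcube that represents a point of it. -/
noncomputable def subcubeLam {d n : ℕ} (a : Fin d → Fin (n + 1) → ℝ) (t : Fin d → Fin n)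
    (f : Fin d → ℝ) : Fin d → Fin (n + 1) → ℝ :=
  fun i j => (1 - subcubeFrac a t f i) * lamVertex (fun i => (t i).castSucc) i j +
    subcubeFrac a t f i * lamVertex (fun i => (t i).succ) i j

section Projection

variable {d n κ : ℕ} {a : Fin d → Fin (n + 1) → ℝ} {θ : (Fin d → ℝ) → Fin κ → ℝ}
  {η : Fin d → ℕ → Fin (Nat.clog 2 n) → Bool}

theorem subcubeFrac_mem (ha : ∀ i, StrictMono (a i)) {t : Fin d → Fin n} {f : Fin d → ℝ}
    (hf : f ∈ subcube a t) (i : Fin d) :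
    0 ≤ subcubeFrac a t f i ∧ subcubeFrac a t f i ≤ 1 := by
  have h := sub_pos.2 (ha i (t i).castSucc_lt_succ)
  exact ⟨div_nonneg (sub_nonneg.2 (hf.1 i)) h.le,
    (div_le_one h).2 (sub_le_sub_right (hf.2 i) _)⟩

theorem sum_subcubeLam (t : Fin d → Fin n) (f : Fin d → ℝ) (i : Fin d)
    (S : Finset (Fin (n + 1))) : ∑ j ∈ S, subcubeLam a t f i j =
      (1 - subcubeFrac a t f i) * (if (t i).castSucc ∈ S then 1 else 0) +
        subcubeFrac a t f i * if (t i).succ ∈ S then 1 else 0 := by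
  simp only [subcubeLam, Finset.sum_add_distrib, ← Finset.mul_sum, sum_lamVertex]

theorem subcubeLam_mem (ha : ∀ i, StrictMono (a i)) {t : Fin d → Fin n} {f : Fin d → ℝ}
    (hf : f ∈ subcube a t) : subcubeLam a t f ∈ Lam d n := by
  intro i _
  obtain ⟨h0, h1⟩ := subcubeFrac_mem ha hf i
  refine ⟨fun j => add_nonneg (mul_nonneg (by linarith) ?_) (mul_nonneg h0 ?_), ?_⟩
  · exact (lamVertex_mem _ i trivial).1 j
  · exact (lamVertex_mem _ i trivial).1 j
  · rw [sum_subcubeLam]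
    simp

theorem mapA_subcubeLam (ha : ∀ i, StrictMono (a i)) (t : Fin d → Fin n) (f : Fin d → ℝ) :
    mapA a (subcubeLam a t f) = f := by
  ext i
  have h := (sub_pos.2 (ha i (t i).castSucc_lt_succ)).ne'
  have h1 := congrFun (mapA_lamVertex a fun i => (t i).castSucc) i
  have h2 := congrFun (mapA_lamVertex a fun i => (t i).succ) i
  simp only [mapA, gridValue] at h1 h2
  simp only [mapA, subcubeLam, mul_add, mul_left_comm (a i _), Finset.sum_add_distrib,
    ← Finset.mul_sum, h1, h2, subcubeFrac]
  field_simp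
  ring

theorem logSOS2_subcubeLam (ha : ∀ i, StrictMono (a i)) {t : Fin d → Fin n} {f : Fin d → ℝ}
    (hf : f ∈ subcube a t) (i : Fin d) :
    LogSOS2 (η i) (subcubeLam a t f i) fun k => if η i (t i + 1) k then 0 else 1 := by
  obtain ⟨h0, h1⟩ := subcubeFrac_mem ha hf i
  refine ⟨subcubeLam_mem ha hf i trivial, fun k => ?_⟩
  obtain ⟨hc, hs⟩ := castSucc_succ_mem_codeSet (η i) (t i) k
  rw [sum_subcubeLam, sum_subcubeLam]
  simp only [Finset.mem_compl]
  cases hb : η i (t i + 1) k <;> rw [hb] at hc hs <;> simp only [hc, hs] <;> constructor <;>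
    simp <;> split_ifs <;> linarith

theorem image_binaryPoints_envelopeRelaxation (hn : 1 ≤ n) (ha : ∀ i, StrictMono (a i))
    (hη : ∀ i, IsGrayCode n (η i))
    (hsuper : ∀ k, SupermodularOver (box a) (fun f => θ f k))
    (hext : ∀ k, ConcaveExtendable (polytopeQ a) (Set.extremePoints ℝ (polytopeQ a))
      (liftLast (n := n) (fun f => θ f k))) :
    Prod.fst '' binaryPoints (envelopeRelaxation a θ η) = unionConvHypo a θ := by
  apply Set.Subset.antisymm
  · rintro _ ⟨p, ⟨hp, hbin⟩, rfl⟩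
    obtain ⟨h1, h2, h3⟩ := (mem_envelopeRelaxation_iff ha hsuper hext p).1 hp
    choose s hs using fun i => (h3 i).exists_segment hn (hη i) fun k => hbin (i, k)
    refine Set.mem_iUnion.2 ⟨s, ?_⟩
    obtain ⟨ω, w, hw, hw1, hdec, hst⟩ :=
      exists_staircase_decomposition (l := p.2.1) fun i _ => (h3 i).1
    set T := Finset.range (d * n + 1)
    have hpP : p.1 = ∑ t ∈ T, w t • ((gridValue a (ω.point t), fun k =>
        θ (gridValue a (ω.point t)) k -
          (staircaseFn a (fun f => θ f k) ω p.2.1 - p.1.2 k)) :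
        (Fin d → ℝ) × (Fin κ → ℝ)) := by
      refine Prod.ext ?_ ?_
      · ext i
        rw [h2 i]
        simp only [Prod.fst_sum, Finset.sum_apply, Prod.smul_fst, Pi.smul_apply, smul_eq_mul,
          ← mapA_lamVertex, mapA, Finset.mul_sum]
        rw [Finset.sum_comm]
        refine Finset.sum_congr rfl fun j _ => ?_
        conv_lhs => rw [hdec]
        simp only [Finset.sum_apply, Pi.smul_apply, smul_eq_mul, Finset.mul_sum]
        exact Finset.sum_congr rfl fun t _ => by ring
      · ext k
        simp only [Prod.snd_sum, Finset.sum_apply, Prod.smul_snd, Pi.smul_apply, smul_eq_mul]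
        have := hst a fun f => θ f k
        simp only [mul_sub (w _) (θ _ k), Finset.sum_sub_distrib, ← Finset.sum_mul, hw1,
          ← this]
        ring
    rw [hpP]
    -- A grid point of positive weight lies in the support of `λ`, hence is a corner of the subcube
    -- `s`.
    refine sum_smul_mem_convexHull T w _ (fun t _ => hw t) hw1 fun t ht hwt => ⟨?_, fun k => ?_⟩
    · have hsupp : ∀ i, ω.point t i = (s i).castSucc ∨ ω.point t i = (s i).succ := by
        intro i
        apply hs i
        rw [hdec]
        simp only [Finset.sum_apply, Pi.smul_apply, smul_eq_mul]
        refine ne_of_gt (Finset.sum_pos' (fun t' _ => mul_nonneg (hw t')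
          ((lamVertex_mem _ i trivial).1 _)) ⟨t, ht, ?_⟩)
        simpa [lamVertex] using lt_of_le_of_ne (hw t) hwt.symm
      have hle := fun i => (ha i (s i).castSucc_lt_succ).le
      constructor <;> intro i <;> rcases hsupp i with h | h <;> simp [gridValue, h, hle i]
    · have := h1 k ω
      dsimp only
      linarith
  · refine Set.iUnion_subset fun t => ?_
    let δ : BinIdx d n → ℝ := fun b => if η b.1 (t b.1 + 1) b.2 then 0 else 1
    have hR := (isPolyhedron_envelopeRelaxation (η := η) ha hsuper hext).convex
    -- With `δ` fixed the slice is convex, so lifting the hypograph itself is enough for its convex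
    -- hull.
    have hconv : Convex ℝ (Prod.fst '' (envelopeRelaxation a θ η ∩ {p | p.2.2 = δ})) := by
      refine (hR.inter ?_).linear_image (LinearMap.fst ℝ _ _)
      intro x hx y hy α β _ _ h
      change α • x.2.2 + β • y.2.2 = δ
      rw [hx, hy, ← add_smul, h, one_smul]
    refine (convexHull_min ?_ hconv).trans (Set.image_mono fun p hp => ⟨hp.1, fun b => ?_⟩)
    · rintro q ⟨hq, hqθ⟩
      refine ⟨(q, subcubeLam a t q.1, δ), ⟨?_, rfl⟩, rfl⟩
      refine (mem_envelopeRelaxation_iff ha hsuper hext _).2 ⟨fun k ω => (hqθ k).trans ?_,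
        fun i => by rw [mapA_subcubeLam ha], logSOS2_subcubeLam ha hq⟩
      have := le_staircaseFn ha (hsuper k) (hext k) ω (subcubeLam_mem ha hq)
      rwa [mapA_subcubeLam ha] at this
    · rw [hp.2]
      simp only [δ]
      split_ifs <;> simp

end Projection

theorem mainTheorem6 (d n κ : ℕ) (hn : 1 ≤ n)
    (a : Fin d → Fin (n + 1) → ℝ) (ha : ∀ i, StrictMono (a i))
    (η : Fin d → ℕ → Fin (Nat.clog 2 n) → Bool) (hη : ∀ i, IsGrayCode n (η i))
    (θ : (Fin d → ℝ) → Fin κ → ℝ)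
    (hsuper : ∀ k, SupermodularOver (box a) (fun f => θ f k))
    (hext : ∀ k, ConcaveExtendable (polytopeQ a) (Set.extremePoints ℝ (polytopeQ a))
      (liftLast (n := n) (fun f => θ f k))) :
    IsIdealMILPFormulation (unionConvHypo a θ) (envelopeRelaxation a θ η) ∧
    (∀ k, ∀ l ∈ Lam d n,
      IsLeast
        (Set.range fun ω : DirectionVector d n =>
          ((staircaseFn a (fun f => θ f k) ω l : ℝ) : EReal))
        (concEnv (Lam d n) (Lam d n) (fun l' => θ (mapA a l') k) l)) ∧
    Module.finrank ℝ (LamSpace d n) = d * (n + 1) ∧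
    Fintype.card (BinIdx d n) = d * Nat.clog 2 n := by
  refine ⟨⟨image_binaryPoints_envelopeRelaxation hn ha hη hsuper hext,
    isPolyhedron_envelopeRelaxation ha hsuper hext,
    fun p hp b => binary_of_mem_extremePoints ha hsuper hext hp b⟩,
    fun k l hl => isLeast_concEnv ha (hsuper k) (hext k) hl, ?_, ?_⟩
  · rw [Module.finrank_pi_fintype]
    simp
  · simp
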